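/- For $\lambda\in\mathbb{C}\setminus\{0,1\}$ let $E_\lambda\colon y^2=x(x-1)(x-\lambda)$ be the Legendre elliptic curve over $\mathbb{C}$. For $\alpha\in\mathbb{C}\setminus\{0,1\}$ let $P_\alpha(\lambda)$ be a point of $E_\lambda(\mathbb{C})$ with $x$-coordinate $\alpha$, and let \[ T(\alpha)=\{\lambda\in\mathbb{C}\setminus\{0,1\} : P_\alpha(\lambda)\text{ is a torsion point of }E_\lambda\}. \] Let $\bar{\mathbb{Q}}$ be the algebraic closure of $\mathbb{Q}$ in $\mathbb{C}$, fix an embedding $i\colon\bar{\mathbb{Q}}\hookrightarrow\bar{\mathbb{Q}}_2$, and let $\rho\colon\bar{\mathbb{Q}}\to\mathbb{P}^1(\bar{\mathbb{F}}_2)=\bar{\mathbb{F}}_2\cup\{\infty\}$ be the associated reduction map: $\rho(a)$ is the residue class of $i(a)$ if $i(a)$ is integral over $\mathbb{Z}_2$, and $\rho(a)=\infty$ otherwise; here $\bar{\mathbb{F}}_2$ is the residue field of the ring of integers of $\bar{\mathbb{Q}}_2$. Theorem. Let $\alpha\in\bar{\mathbb{Q}}\setminus\{0,1\}$. Then there is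 a subset $T'(\alpha)\subseteq\bar{\mathbb{Q}}$ such that $T(\alpha)=\{\alpha\}\cup T'(\alpha)$ and $\rho(T'(\alpha))\subseteq\{\rho(\alpha^2)\}$. In other words, $\alpha\in T(\alpha)\subseteq\bar{\mathbb{Q}}$, and every $\lambda\in T(\alpha)$ with $\lambda\neq\alpha$ satisfies $\rho(\lambda)=\rho(\alpha^2)$. -/

import Mathlib

noncomputable section

/-- The Legendre curve `E_t : y² = x (x - 1) (x - t) = x³ - (1 + t) x² + t x` over `ℂ`. -/
def legendreCurve (t : ℂ) : WeierstrassCurve.Affine ℂ where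
  a₁ := 0
  a₂ := -(1 + t)
  a₃ := 0
  a₄ := t
  a₆ := 0

/-- The affine equation of `legendreCurve t` is the Legendre equation. -/
theorem legendreCurve_equation_iff (t x y : ℂ) :
    (legendreCurve t).Equation x y ↔ y ^ 2 = x * (x - 1) * (x - t) := by
  rw [WeierstrassCurve.Affine.equation_iff]
  simp only [legendreCurve]
  constructor <;> intro h <;> linear_combination h

/-- For `t ≠ 0, 1`, the curve `legendreCurve t` is nonsingular: its discriminant does not vanish. -/
theorem legendreCurve_discr (t : ℂ) : (legendreCurve t).Δ = 16 * t ^ 2 * (t - 1) ^ 2 := by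
  simp only [legendreCurve, WeierstrassCurve.Δ, WeierstrassCurve.b₂, WeierstrassCurve.b₄,
    WeierstrassCurve.b₆, WeierstrassCurve.b₈]
  ring

/-- `T(a)`: the set of all `t ∈ ℂ \ {0, 1}` such that a point of `E_t(ℂ)` with `x`-coordinate `a`
is torsion, i.e. has finite order in the group `E_t(ℂ)`. (There are at most two such points, and
they are negatives of each other.) -/
def torsionParameters (a : ℂ) : Set ℂ :=
  {t | t ≠ 0 ∧ t ≠ 1 ∧ ∃ (y : ℂ) (h : (legendreCurve t).Nonsingular a y),
    IsOfFinAddOrder (WeierstrassCurve.Affine.Point.some a y h)}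

/-- `ℚ̄`, the algebraic closure of `ℚ` in `ℂ`. -/
abbrev QBar : Type := algebraicClosure ℚ ℂ

/-- `ℤ̄₂`, the valuation ring of `ℚ̄₂ = PadicAlgCl 2`, consisting of the integral elements. -/
abbrev ZBarTwo : ValuationSubring (PadicAlgCl 2) :=
  (Valued.v : Valuation (PadicAlgCl 2) NNReal).valuationSubring

/-- `𝔽̄₂`, as the residue field of `ℤ̄₂`. -/
abbrev FBarTwo : Type := IsLocalRing.ResidueField ZBarTwo

theorem mem_ZBarTwo_iff (x : PadicAlgCl 2) : x ∈ ZBarTwo ↔ ‖x‖ ≤ 1 := by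
  rw [Valuation.mem_valuationSubring_iff, PadicAlgCl.valuation_def]
  rfl

theorem two_eq_zero_FBarTwo : (2 : FBarTwo) = 0 := by
  have h : IsLocalRing.residue ZBarTwo 2 = 0 := by
    rw [IsLocalRing.residue_eq_zero_iff, IsLocalRing.mem_maximalIdeal, mem_nonunits_iff]
    intro hu
    obtain ⟨b, hb⟩ := hu.exists_right_inv
    have hb' : (2 : PadicAlgCl 2) * (b : PadicAlgCl 2) = 1 := by
      have := congrArg (Subtype.val) hb
      exact this
    have h1 := (mem_ZBarTwo_iff b).1 b.2
    have h2 : ‖(2 : PadicAlgCl 2)‖ = 1 / 2 := by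
      have := PadicAlgCl.valuation_p 2
      rw [PadicAlgCl.valuation_def] at this
      have := congrArg NNReal.toReal this
      simpa using this
    have h3 := congrArg norm hb'
    rw [norm_mul, h2, norm_one] at h3
    linarith
  exact h

instance : CharP FBarTwo 2 :=
  CharTwo.of_one_ne_zero_of_two_eq_zero one_ne_zero two_eq_zero_FBarTwo

instance : Algebra (ZMod 2) FBarTwo := ZMod.algebra FBarTwo 2

/-- The residue field of `ℤ̄₂` is an algebraic closure of `𝔽₂`. -/
instance : IsAlgClosure (ZMod 2) FBarTwo where
  isAlgClosed := by
    refine IsAlgClosed.of_exists_root _ fun p hp hirr => ?_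
    have hl : p ∈ Polynomial.lifts (IsLocalRing.residue ZBarTwo) :=
      (Polynomial.mem_lifts p).2
        (Polynomial.map_surjective _ IsLocalRing.residue_surjective p)
    obtain ⟨q, hq, hdeg, hmon⟩ := Polynomial.lifts_and_natDegree_eq_and_monic hl hp
    have hd : (q.map (algebraMap ZBarTwo (PadicAlgCl 2))).degree ≠ 0 := by
      rw [hmon.degree_map]
      intro h0
      have h1 : q = 1 := hmon.natDegree_eq_zero.1 (Polynomial.natDegree_eq_of_degree_eq_some h0)
      apply hirr.not_isUnit
      rw [← hq, h1, Polynomial.map_one]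
      exact isUnit_one
    obtain ⟨x, hx⟩ := IsAlgClosed.exists_root _ hd
    rw [Polynomial.IsRoot, Polynomial.eval_map] at hx
    obtain ⟨y, rfl⟩ := IsIntegrallyClosed.isIntegral_iff.1 (⟨q, hmon, hx⟩ : IsIntegral ZBarTwo x)
    rw [Polynomial.eval₂_at_apply] at hx
    refine ⟨IsLocalRing.residue ZBarTwo y, ?_⟩
    have hy : q.eval y = 0 := by
      apply (FaithfulSMul.algebraMap_injective ZBarTwo (PadicAlgCl 2))
      rw [map_zero]
      exact hx
    rw [← hq, Polynomial.eval_map, Polynomial.eval₂_hom, hy, map_zero]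
  isAlgebraic := by
    refine ⟨fun x => ?_⟩
    obtain ⟨x, rfl⟩ := IsLocalRing.residue_surjective x
    have halg : IsIntegral ℚ_[2] (x : PadicAlgCl 2) :=
      Algebra.IsIntegral.isIntegral (R := ℚ_[2]) (x : PadicAlgCl 2)
    have hmon := minpoly.monic halg
    have hcoeff : ∀ n, ‖(minpoly ℚ_[2] (x : PadicAlgCl 2)).coeff n‖ ≤ 1 :=
      (spectralValue_le_one_iff hmon).1 ((mem_ZBarTwo_iff x).1 x.2)
    have hl : minpoly ℚ_[2] (x : PadicAlgCl 2) ∈ Polynomial.lifts (algebraMap ℤ_[2] ℚ_[2]) :=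
      (Polynomial.lifts_iff_coeff_lifts _).2 fun n => ⟨⟨_, hcoeff n⟩, rfl⟩
    obtain ⟨q, hq, -, hqmon⟩ := Polynomial.lifts_and_natDegree_eq_and_monic hl hmon
    let φ : ℤ_[2] →+* ZBarTwo :=
      ((algebraMap ℚ_[2] (PadicAlgCl 2)).comp (algebraMap ℤ_[2] ℚ_[2])).codRestrict
        ZBarTwo (fun z => (mem_ZBarTwo_iff _).2 (by
          rw [RingHom.comp_apply, norm_algebraMap']
          exact z.2))
    have hqx : q.eval₂ φ x = 0 := by
      apply FaithfulSMul.algebraMap_injective ZBarTwo (PadicAlgCl 2)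
      rw [map_zero, Polynomial.hom_eval₂]
      have := minpoly.aeval ℚ_[2] (x : PadicAlgCl 2)
      rw [← hq, Polynomial.aeval_def, Polynomial.eval₂_map] at this
      exact this
    have hrange : ∀ z : ℤ_[2], ∃ c : ZMod 2,
        algebraMap (ZMod 2) FBarTwo c = IsLocalRing.residue ZBarTwo (φ z) := by
      intro z
      obtain ⟨n, -, hn⟩ := PadicInt.exists_mem_range z
      rw [PadicInt.maximalIdeal_eq_span_p, Ideal.mem_span_singleton] at hn
      obtain ⟨w, hw⟩ := hn
      refine ⟨n, ?_⟩
      rw [sub_eq_iff_eq_add.1 hw]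
      have h2 := two_eq_zero_FBarTwo
      simp only [map_add, map_mul, map_natCast, Nat.cast_ofNat, map_ofNat]
      rw [h2, zero_mul, zero_add]
    have hl2 : q.map ((IsLocalRing.residue ZBarTwo).comp φ) ∈
        Polynomial.lifts (algebraMap (ZMod 2) FBarTwo) :=
      (Polynomial.lifts_iff_coeff_lifts _).2 fun n => by
        rw [Polynomial.coeff_map]
        exact hrange _
    obtain ⟨r, hr, -, hrmon⟩ :=
      Polynomial.lifts_and_natDegree_eq_and_monic hl2 (hqmon.map _)
    refine ⟨r, hrmon.ne_zero, ?_⟩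
    rw [Polynomial.aeval_def, ← Polynomial.eval_map, hr, Polynomial.eval_map,
      ← Polynomial.hom_eval₂, hqx, map_zero]

/-- The reduction map `ρ : ℚ̄ → ℙ¹(ℚ̄₂) → ℙ¹(𝔽̄₂) = 𝔽̄₂ ∪ {∞}` attached to an embedding
`i : ℚ̄ → ℚ̄₂`: the residue class of `i a` if `i a` is integral, and `∞` otherwise. -/
def reductionMap (i : QBar →+* PadicAlgCl 2) (a : QBar) : OnePoint FBarTwo :=
  open Classical in
  if h : i a ∈ ZBarTwo then ((IsLocalRing.residue ZBarTwo ⟨i a, h⟩ : FBarTwo) : OnePoint FBarTwo)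
  else OnePoint.infty

end

/-!
Torsion is excluded by watching the doubling map at a place of residue characteristic two. On
`E_t : y² = x(x - 1)(x - t)` one has `x(2P) = (x² - t)² / (4x(x - 1)(x - t))`, and the factor `4`
in the denominator is small. If `|x| > 1` and `|x| > |t|`, then `|x(2P)| = |x| / |4| > |x|`, so
the values of the `x`-coordinates of `2ⁿP` increase strictly and `P` is not torsion
(`not_isOfFinAddOrder_of_lt_xValuation`). For `x(P) = α` and `t ≠ α` this region is reached after
at most one doubling in each of the following cases:

* `|t| ≤ 1 < |α|` (already without doubling);
* `|α|, |t| ≤ 1` and `|α² - t| = 1`;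
* `|α| ≤ 1 < |t|`.

For `t ∈ ℚ̄` these are exactly the cases in which `t` and `α²` have different reductions.

The argument needs no discreteness or rank-one hypothesis, only a valuation ring of `ℂ` above the
one that `i` defines on `ℚ̄`. If `t` is transcendental over `ℚ̄`, such a ring can be chosen with
`t` or `t⁻¹` in its maximal ideal (`exists_dominates_of_transcendental`), which puts `t` in the
first or the third case, according to whether `α` is integral. Hence `T(α) ⊆ ℚ̄`.
-/

/-! ### Doubling on the Legendre curve -/

open WeierstrassCurve.Affine

/-- The duplication formula `x(2P) · 4x(x - 1)(x - t) = (x² - t)²` on `y² = x(x - 1)(x - t)`. -/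
theorem legendreCurve_exists_add_self {t x y : ℂ} (h : (legendreCurve t).Nonsingular x y)
    (hx : x * (x - 1) * (x - t) ≠ 0) :
    ∃ (x' y' : ℂ) (h' : (legendreCurve t).Nonsingular x' y'),
      Point.some x y h + Point.some x y h = Point.some x' y' h' ∧
        x' * (2 * 2 * (x * (x - 1) * (x - t))) = (x ^ 2 - t) ^ 2 := by
  have he := (legendreCurve_equation_iff t x y).1 h.1
  have hy0 : y ≠ 0 := by
    rintro rfl
    exact hx (by rw [← he]; ring)
  have hneg : (legendreCurve t).negY x y = -y := by simp [negY, legendreCurve]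
  have hy : y ≠ (legendreCurve t).negY x y := by
    rw [hneg]
    exact fun h => hy0 (self_eq_neg.1 h)
  refine ⟨_, _, _, Point.add_self_of_Y_ne hy, ?_⟩
  rw [slope_of_Y_ne rfl hy, hneg, addX]
  simp only [legendreCurve]
  have hy2 : y - -y ≠ 0 := by
    rw [sub_neg_eq_add, ← two_mul]
    exact mul_ne_zero two_ne_zero hy0
  rw [← he]
  field_simp
  ring_nf
  ring_nf at he
  simp only [he]
  ring

/-- For `t = a` the point with `x`-coordinate `a` is `(a, 0)`, which has order two. -/
theorem mem_torsionParameters_self {a : ℂ} (h0 : a ≠ 0) (h1 : a ≠ 1) :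
    a ∈ torsionParameters a := by
  have hns : (legendreCurve a).Nonsingular a 0 := by
    refine (equation_iff_nonsingular_of_Δ_ne_zero ?_).1
      ((legendreCurve_equation_iff _ _ _).2 (by ring))
    rw [legendreCurve_discr]
    exact mul_ne_zero (mul_ne_zero (by norm_num) (pow_ne_zero 2 h0))
      (pow_ne_zero 2 (sub_ne_zero.2 h1))
  refine ⟨h0, h1, 0, hns, isOfFinAddOrder_iff_nsmul_eq_zero.2 ⟨2, two_pos, ?_⟩⟩
  rw [two_nsmul]
  exact Point.add_self_of_Y_eq (by simp [negY, legendreCurve])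

/-! ### Escape of the doubling orbit at a place of residue characteristic two -/

section Escape

variable {Γ : Type*} [LinearOrderedCommGroupWithZero Γ] (v : Valuation ℂ Γ)

/-- The value of the `x`-coordinate of a point; the point at infinity gets the value `0`. -/
def xValuation {t : ℂ} : (legendreCurve t).Point → Γ
  | .zero => 0
  | .some x _ _ => v x

theorem xValuation_some {t x y : ℂ} (h : (legendreCurve t).Nonsingular x y) :
    xValuation v (Point.some x y h) = v x := rfl

variable {v}

theorem lt_of_mul_eq_of_lt_one {u c a : Γ} (hc : c < 1) (ha : a ≠ 0) (h : u * c = a) : a < u := by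
  have hu : u ≠ 0 := by
    rintro rfl
    exact ha (by rw [← h, zero_mul])
  rw [← h]
  exact mul_lt_of_lt_one_right (zero_lt_iff.2 hu) hc

/-- Once `x` is large compared with `1` and `t`, one has `|x(2P)| = |x| / |4|`. -/
theorem xValuation_lt_add_self (h2 : v 2 < 1) {t : ℂ} {P : (legendreCurve t).Point}
    (h1P : 1 < xValuation v P) (htP : v t < xValuation v P) :
    xValuation v P < xValuation v (P + P) := by
  rcases P with _ | ⟨x, y, h⟩
  · exact absurd h1P not_lt_zero
  rw [xValuation_some] at h1P htP
  have ha : v x ≠ 0 := (zero_lt_one.trans h1P).ne'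
  have hx1 : v (x - 1) = v x := v.map_sub_eq_of_lt_left (by rwa [map_one])
  have hxt : v (x - t) = v x := v.map_sub_eq_of_lt_left htP
  have hx2 : v (x ^ 2 - t) = v x ^ 2 := by
    rw [v.map_sub_eq_of_lt_left, map_pow]
    rw [map_pow, pow_two]
    exact htP.trans (lt_mul_of_one_lt_right (zero_lt_iff.2 ha) h1P)
  obtain ⟨x', y', h', hadd, hx'⟩ := legendreCurve_exists_add_self h (by
    rw [← v.ne_zero_iff, map_mul, map_mul, hx1, hxt]
    exact mul_ne_zero (mul_ne_zero ha ha) ha)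
  rw [hadd, xValuation_some, xValuation_some]
  have hv := congrArg v hx'
  simp only [map_mul, map_pow, hx1, hxt, hx2] at hv
  refine lt_of_mul_eq_of_lt_one (mul_lt_one' h2 h2) ha
    (mul_right_cancel₀ (pow_ne_zero 3 ha) ?_)
  rw [pow_succ, pow_two, mul_assoc, hv, pow_two, pow_two]
  ac_rfl

theorem not_isOfFinAddOrder_of_lt_xValuation (h2 : v 2 < 1) {t : ℂ} {P : (legendreCurve t).Point}
    (h1P : 1 < xValuation v P) (htP : v t < xValuation v P) : ¬ IsOfFinAddOrder P := by
  intro hfin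
  have hsucc (n : ℕ) : 2 ^ (n + 1) • P = 2 ^ n • P + 2 ^ n • P := by
    rw [pow_succ, mul_nsmul, two_nsmul]
  have hlarge (n : ℕ) : 1 < xValuation v (2 ^ n • P) ∧ v t < xValuation v (2 ^ n • P) := by
    induction n with
    | zero => simpa using ⟨h1P, htP⟩
    | succ n ih =>
      rw [hsucc]
      have := xValuation_lt_add_self h2 ih.1 ih.2
      exact ⟨ih.1.trans this, ih.2.trans this⟩
  have hmono : StrictMono fun n : ℕ => xValuation v (2 ^ n • P) :=
    strictMono_nat_of_lt_succ fun n => by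
      rw [hsucc]
      exact xValuation_lt_add_self h2 (hlarge n).1 (hlarge n).2
  have hinj : Function.Injective fun n : ℕ => 2 ^ n • P :=
    fun m n hmn => hmono.injective (congrArg (xValuation v) hmn)
  refine Set.infinite_of_injective_forall_mem hinj (fun n => ?_) (finite_multiples.2 hfin)
  exact ⟨2 ^ n, rfl⟩

/-- It suffices that the point reached by one doubling is large. -/
theorem not_isOfFinAddOrder_of_large_double (h2 : v 2 < 1) {t x y : ℂ}
    (h : (legendreCurve t).Nonsingular x y) (hx : x * (x - 1) * (x - t) ≠ 0)
    (hlarge : ∀ x', x' * (2 * 2 * (x * (x - 1) * (x - t))) = (x ^ 2 - t) ^ 2 →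
      1 < v x' ∧ v t < v x') : ¬ IsOfFinAddOrder (Point.some x y h) := by
  intro hfin
  obtain ⟨x', y', h', hadd, hx'⟩ := legendreCurve_exists_add_self h hx
  obtain ⟨h1, ht⟩ := hlarge x' hx'
  refine not_isOfFinAddOrder_of_lt_xValuation (P := Point.some x' y' h') h2 h1 ht ?_
  rw [← hadd]
  exact hfin.add hfin

theorem not_mem_torsionParameters_of_one_lt (h2 : v 2 < 1) {a t : ℂ} (ht : v t ≤ 1)
    (ha : 1 < v a) : t ∉ torsionParameters a := by
  rintro ⟨-, -, y, h, hfin⟩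
  exact not_isOfFinAddOrder_of_lt_xValuation (P := Point.some a y h) h2 ha (ht.trans_lt ha) hfin

theorem not_mem_torsionParameters_of_sq_sub_eq_one (h2 : v 2 < 1) {a t : ℂ} (h0 : a ≠ 0)
    (h1 : a ≠ 1) (hta : t ≠ a) (ha : v a ≤ 1) (ht : v t ≤ 1) (hat : v (a ^ 2 - t) = 1) :
    t ∉ torsionParameters a := by
  rintro ⟨-, -, y, h, hfin⟩
  have hne : a * (a - 1) * (a - t) ≠ 0 :=
    mul_ne_zero (mul_ne_zero h0 (sub_ne_zero.2 h1)) (sub_ne_zero.2 hta.symm)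
  refine not_isOfFinAddOrder_of_large_double h2 h hne (fun x' hx' => ?_) hfin
  have hv := congrArg v hx'
  rw [map_mul, map_pow, hat, one_pow] at hv
  have hden : v (2 * 2 * (a * (a - 1) * (a - t))) < 1 := by
    rw [map_mul, map_mul, map_mul, map_mul]
    have ha1 : v (a - 1) ≤ 1 := v.map_sub_le ha (by rw [map_one])
    exact mul_lt_one_of_lt_of_le (mul_lt_one' h2 h2)
      (mul_le_one' (mul_le_one' ha ha1) (v.map_sub_le ha ht))
  have := lt_of_mul_eq_of_lt_one hden one_ne_zero hv
  exact ⟨this, ht.trans_lt this⟩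

theorem not_mem_torsionParameters_of_le_one_of_one_lt (h2 : v 2 < 1) {a t : ℂ} (h0 : a ≠ 0)
    (h1 : a ≠ 1) (ha : v a ≤ 1) (ht : 1 < v t) : t ∉ torsionParameters a := by
  rintro ⟨-, -, y, h, hfin⟩
  have hta : v (a - t) = v t := v.map_sub_eq_of_lt_right (ha.trans_lt ht)
  have hne : a * (a - 1) * (a - t) ≠ 0 :=
    mul_ne_zero (mul_ne_zero h0 (sub_ne_zero.2 h1))
      ((v.ne_zero_iff).1 (by rw [hta]; exact (zero_lt_one.trans ht).ne'))
  refine not_isOfFinAddOrder_of_large_double h2 h hne (fun x' hx' => ?_) hfin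
  have ht0 : v t ≠ 0 := (zero_lt_one.trans ht).ne'
  have hat : v (a ^ 2 - t) = v t :=
    v.map_sub_eq_of_lt_right (by rw [map_pow]; exact (pow_le_one' ha 2).trans_lt ht)
  have hv := congrArg v hx'
  simp only [map_mul, map_pow, hat, hta] at hv
  have ha1 : v (a - 1) ≤ 1 := v.map_sub_le ha (by rw [map_one])
  have hc : v 2 * v 2 * (v a * v (a - 1)) < 1 :=
    mul_lt_one_of_lt_of_le (mul_lt_one' h2 h2) (mul_le_one' ha ha1)
  have := lt_of_mul_eq_of_lt_one (u := v x') hc ht0 (mul_right_cancel₀ ht0 (by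
    rw [← pow_two (v t), ← hv]; ac_rfl))
  exact ⟨ht.trans this, this⟩

end Escape

/-! ### Valuation rings of `ℂ` above the given one of `ℚ̄` -/

/-- If `R` embeds in a field `K` and `g` maps `R` to a nontrivial ring, then some valuation ring
of `K` contains `R` and has `ker g` in its maximal ideal. -/
theorem exists_valuationSubring_of_ringHom {R K k : Type*} [CommRing R] [Field K] [CommRing k]
    [Nontrivial k] (f : R →+* K) (hf : Function.Injective f) (g : R →+* k) :
    ∃ B : ValuationSubring K, (∀ r, B.valuation (f r) ≤ 1) ∧
      ∀ r, g r = 0 → B.valuation (f r) < 1 := by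
  have hI : (RingHom.ker g).map f.rangeRestrict ≠ ⊤ := by
    rw [Ne, Ideal.eq_top_iff_one,
      Ideal.mem_map_iff_of_surjective _ f.rangeRestrict_surjective]
    rintro ⟨r, hr, hr1⟩
    have : r = 1 := hf (by simpa using congrArg Subtype.val hr1)
    rw [this, RingHom.mem_ker, map_one] at hr
    exact one_ne_zero hr
  obtain ⟨B, hB, hIB⟩ := Ideal.image_subset_nonunits_valuationSubring _ hI
  refine ⟨B, fun r => (B.valuation_le_one_iff _).2 (hB ⟨r, rfl⟩), fun r hr => ?_⟩
  exact B.mem_nonunits_iff.1 (hIB ⟨f.rangeRestrict r, Ideal.mem_map_of_mem _ hr, rfl⟩)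

section Extension

variable (i : QBar →+* PadicAlgCl 2)

/-- The ring of elements of `ℚ̄` that `i` maps to integral elements. -/
noncomputable def integralSubring : Subring QBar := ZBarTwo.toSubring.comap i

theorem mem_integralSubring_iff {a : QBar} : a ∈ integralSubring i ↔ ‖i a‖ ≤ 1 :=
  mem_ZBarTwo_iff (i a)

/-- Reduction of the elements of `integralSubring i` modulo the maximal ideal of `ℤ̄₂`. -/
noncomputable def integralReduction : integralSubring i →+* FBarTwo :=
  (IsLocalRing.residue ZBarTwo).comp
    ((i.comp (integralSubring i).subtype).codRestrict ZBarTwo fun a => a.2)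

theorem residue_eq_zero_iff_norm_lt_one (x : ZBarTwo) :
    IsLocalRing.residue ZBarTwo x = 0 ↔ ‖(x : PadicAlgCl 2)‖ < 1 := by
  rw [IsLocalRing.residue_eq_zero_iff, ValuationSubring.valuation_lt_one_iff,
    (Valuation.isEquiv_valuation_valuationSubring _).symm.lt_one_iff_lt_one,
    PadicAlgCl.valuation_def]
  rfl

theorem integralReduction_eq_zero_iff (a : integralSubring i) :
    integralReduction i a = 0 ↔ ‖i a‖ < 1 :=
  residue_eq_zero_iff_norm_lt_one _

/-- The valuation ring `B` of `ℂ` dominates the valuation ring of `ℚ̄` defined by `i`. -/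
def Dominates (B : ValuationSubring ℂ) : Prop :=
  ∀ a : QBar, (‖i a‖ ≤ 1 → B.valuation (a : ℂ) ≤ 1) ∧ (‖i a‖ < 1 → B.valuation (a : ℂ) < 1)

variable {i}

theorem Dominates.one_lt {B : ValuationSubring ℂ} (hB : Dominates i B) {a : QBar}
    (ha : 1 < ‖i a‖) : 1 < B.valuation (a : ℂ) := by
  have := (hB a⁻¹).2 (by rw [map_inv₀, norm_inv]; exact inv_lt_one_of_one_lt₀ ha)
  have h0 : (a : ℂ) ≠ 0 := by
    intro h
    rw [ZeroMemClass.coe_eq_zero.1 h, map_zero, norm_zero] at ha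
    exact absurd ha (by norm_num)
  exact (B.valuation.one_lt_val_iff h0).2 (by simpa using this)

theorem Dominates.eq_one {B : ValuationSubring ℂ} (hB : Dominates i B) {a : QBar}
    (ha : ‖i a‖ = 1) : B.valuation (a : ℂ) = 1 := by
  refine le_antisymm ((hB a).1 ha.le) ?_
  have := (hB a⁻¹).1 (by rw [map_inv₀, norm_inv, ha, inv_one])
  have h0 : (a : ℂ) ≠ 0 := by
    intro h
    rw [ZeroMemClass.coe_eq_zero.1 h, map_zero, norm_zero] at ha
    exact zero_ne_one ha
  exact (B.valuation.one_le_val_iff h0).2 (by simpa using this)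

theorem Dominates.two_lt {B : ValuationSubring ℂ} (hB : Dominates i B) : B.valuation 2 < 1 := by
  have h := (residue_eq_zero_iff_norm_lt_one 2).1 two_eq_zero_FBarTwo
  exact (hB 2).2 (by rw [map_ofNat]; exact h)

variable (i)

theorem exists_dominates : ∃ B : ValuationSubring ℂ, Dominates i B := by
  obtain ⟨B, h1, h2⟩ := exists_valuationSubring_of_ringHom
    ((algebraMap QBar ℂ).comp (integralSubring i).subtype)
    ((algebraMap QBar ℂ).injective.comp Subtype.val_injective) (integralReduction i)
  exact ⟨B, fun a => ⟨fun ha => h1 ⟨a, (mem_integralSubring_iff i).2 ha⟩,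
    fun ha => h2 ⟨a, (mem_integralSubring_iff i).2 ha.le⟩
      ((integralReduction_eq_zero_iff i _).2 ha)⟩⟩

open Polynomial in
/-- For `s` transcendental, evaluation at `s` embeds `R[X]` in `ℂ`, where `R` is the valuation
ring of `ℚ̄`, so that the residue of `s` can be prescribed to be `0`. -/
theorem exists_dominates_of_transcendental {s : ℂ} (hs : Transcendental QBar s) :
    ∃ B : ValuationSubring ℂ, Dominates i B ∧ B.valuation s < 1 := by
  let f : (integralSubring i)[X] →+* ℂ :=
    (aeval s : QBar[X] →ₐ[QBar] ℂ).toRingHom.comp (mapRingHom (integralSubring i).subtype)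
  have hf : Function.Injective f :=
    (transcendental_iff_injective.1 hs).comp (map_injective _ Subtype.val_injective)
  have hfC (a) : f (C a) = ((a : QBar) : ℂ) := by
    simp only [f, RingHom.comp_apply, AlgHom.toRingHom_eq_coe, RingHom.coe_coe, coe_mapRingHom,
      map_C, aeval_C]
    rfl
  have hfX : f X = s := by simp [f]
  obtain ⟨B, h1, h2⟩ := exists_valuationSubring_of_ringHom f hf
    ((integralReduction i).comp (evalRingHom 0))
  refine ⟨B, fun a => ⟨fun ha => ?_, fun ha => ?_⟩, ?_⟩
  · rw [← hfC ⟨a, (mem_integralSubring_iff i).2 ha⟩]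
    exact h1 _
  · rw [← hfC ⟨a, (mem_integralSubring_iff i).2 ha.le⟩]
    refine h2 _ ?_
    rw [RingHom.comp_apply, coe_evalRingHom, eval_C]
    exact (integralReduction_eq_zero_iff i _).2 ha
  · rw [← hfX]
    refine h2 _ ?_
    rw [RingHom.comp_apply, coe_evalRingHom, eval_X, map_zero]

end Extension

/-! ### Torsion parameters are algebraic and reduce to `ρ(α²)` -/

theorem transcendental_QBar_of_not_mem {t : ℂ} (ht : t ∉ algebraicClosure ℚ ℂ) :
    Transcendental QBar t := by
  intro h
  have : Algebra.IsAlgebraic ℚ QBar := algebraicClosure.isAlgebraic ℚ ℂ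
  exact ht (mem_algebraicClosure_iff.2 (h.restrictScalars ℚ (S := QBar)))

/-- For transcendental `t` some valuation ring dominating that of `ℚ̄` makes `t` small or large,
whichever contradicts torsion at `α`. -/
theorem mem_algebraicClosure_of_mem_torsionParameters (i : QBar →+* PadicAlgCl 2) {α : QBar}
    (h0 : α ≠ 0) (h1 : α ≠ 1) {t : ℂ} (ht : t ∈ torsionParameters (α : ℂ)) :
    t ∈ algebraicClosure ℚ ℂ := by
  by_contra hmem
  have htr := transcendental_QBar_of_not_mem hmem
  rcases le_or_gt ‖i α‖ 1 with hα | hα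
  · obtain ⟨B, hB, hs⟩ := exists_dominates_of_transcendental i (s := t⁻¹)
      (fun h => htr (by simpa using h.inv))
    exact not_mem_torsionParameters_of_le_one_of_one_lt hB.two_lt (by simpa using h0)
      (by simpa using h1) ((hB α).1 hα) ((B.valuation.one_lt_val_iff ht.1).2 hs) ht
  · obtain ⟨B, hB, hs⟩ := exists_dominates_of_transcendental i htr
    exact not_mem_torsionParameters_of_one_lt hB.two_lt hs.le (hB.one_lt hα) ht

theorem reductionMap_eq_infty {i : QBar →+* PadicAlgCl 2} {a : QBar} (ha : 1 < ‖i a‖) :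
    reductionMap i a = OnePoint.infty :=
  dif_neg fun h => ha.not_ge ((mem_ZBarTwo_iff _).1 h)

theorem reductionMap_eq_of_norm_sub_lt_one {i : QBar →+* PadicAlgCl 2} {a b : QBar}
    (ha : ‖i a‖ ≤ 1) (hb : ‖i b‖ ≤ 1) (hab : ‖i (a - b)‖ < 1) :
    reductionMap i a = reductionMap i b := by
  rw [reductionMap, reductionMap, dif_pos ((mem_ZBarTwo_iff _).2 ha),
    dif_pos ((mem_ZBarTwo_iff _).2 hb)]
  congr 1
  rw [← sub_eq_zero, ← map_sub, residue_eq_zero_iff_norm_lt_one]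
  rwa [map_sub] at hab

theorem reductionMap_eq_of_mem_torsionParameters (i : QBar →+* PadicAlgCl 2) {α t : QBar}
    (h0 : α ≠ 0) (h1 : α ≠ 1) (htα : t ≠ α) (ht : (t : ℂ) ∈ torsionParameters (α : ℂ)) :
    reductionMap i t = reductionMap i (α ^ 2) := by
  obtain ⟨B, hB⟩ := exists_dominates i
  have h0' : (α : ℂ) ≠ 0 := by simpa using h0
  have h1' : (α : ℂ) ≠ 1 := by simpa using h1
  rcases le_or_gt ‖i α‖ 1 with hα | hα
  · have hα2 : ‖i (α ^ 2)‖ ≤ 1 := by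
      rw [map_pow, norm_pow]
      exact pow_le_one₀ (norm_nonneg _) hα
    have hti : ‖i t‖ ≤ 1 := by
      by_contra! hti
      exact not_mem_torsionParameters_of_le_one_of_one_lt hB.two_lt h0' h1' ((hB α).1 hα)
        (hB.one_lt hti) ht
    refine (reductionMap_eq_of_norm_sub_lt_one hα2 hti ?_).symm
    have hle : ‖i (α ^ 2 - t)‖ ≤ 1 :=
      (mem_integralSubring_iff i).1 (sub_mem ((mem_integralSubring_iff i).2 hα2)
        ((mem_integralSubring_iff i).2 hti))
    refine hle.lt_of_ne fun heq => ?_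
    exact not_mem_torsionParameters_of_sq_sub_eq_one hB.two_lt h0' h1'
      (by simpa using htα) ((hB α).1 hα) ((hB t).1 hti) (by simpa using hB.eq_one heq) ht
  · have hα2 : 1 < ‖i (α ^ 2)‖ := by
      rw [map_pow, norm_pow]
      exact one_lt_pow₀ hα two_ne_zero
    have hti : 1 < ‖i t‖ := by
      by_contra! hti
      exact not_mem_torsionParameters_of_one_lt hB.two_lt ((hB t).1 hti) (hB.one_lt hα) ht
    rw [reductionMap_eq_infty hti, reductionMap_eq_infty hα2]

theorem theoremT (i : QBar →+* PadicAlgCl 2) (α : QBar) (h0 : α ≠ 0) (h1 : α ≠ 1) :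
    ∃ T' : Set QBar,
      torsionParameters (α : ℂ) = {(α : ℂ)} ∪ (fun t : QBar => (t : ℂ)) '' T' ∧
      reductionMap i '' T' ⊆ {reductionMap i (α ^ 2)} := by
  refine ⟨{t | t ≠ α ∧ (t : ℂ) ∈ torsionParameters (α : ℂ)}, ?_, ?_⟩
  · ext t
    constructor
    · intro ht
      by_cases hta : t = α
      · exact Or.inl hta
      · refine Or.inr ⟨⟨t, mem_algebraicClosure_of_mem_torsionParameters i h0 h1 ht⟩, ⟨?_, ht⟩, rfl⟩
        exact fun h => hta (congrArg Subtype.val h)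
    · rintro (rfl | ⟨t, ⟨-, ht⟩, rfl⟩)
      · exact mem_torsionParameters_self (by simpa using h0) (by simpa using h1)
      · exact ht
  · rintro _ ⟨t, ⟨hta, ht⟩, rfl⟩
    exact reductionMap_eq_of_mem_torsionParameters i h0 h1 hta ht
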